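/- Let $X=\{(x_1,x_2)\in\mathbb R^2: x_1,x_2>0,\ x_1^2+x_2^2<1\}$ be the open quarter disk, let $\mu$ be the uniform probability measure on $X$, and let $c(x,y)=-x\cdot(\cos y,\sin y)$. For $\bar y>0$ put $Y=(0,\bar y)$, and for a Borel probability measure $\nu$ on $\bar Y=[0,\bar y]$ put $$\mathcal T_c(\mu,\nu)=\inf_{\gamma\in\Pi(\mu,\nu)}\int c\,d\gamma,\qquad \mathcal F(\nu)=\int_Y\bar\nu\ln\bar\nu\,dy,$$ where $\Pi(\mu,\nu)$ is the set of couplings of $\mu$ and $\nu$ and $\bar\nu$ is the Lebesgue density of $\nu$, with $\mathcal F(\nu)=+\infty$ if $\nu$ is not absolutely continuous. For $y\in\bar Y$ and $k\in\mathbb R$ let $X_\ge(y,k)=\{x\in X:\partial_yc(x,y)\ge k\}$ and $X_>(y,k)=\{x\in X:\partial_yc(x,y)>k\}$. Let $\nu$ be any minimizer of $\nu\mapsto\mathcal T_c(\mu,\nu)+\mathcal F(\nu)$ over the Borel probability measures on $\bar Y$. If $$\bar y\le\ln\Big(\frac{1+\sqrt{1+2\pi}}2\Big)\approx0.61,$$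 then the model $(c,\mu,\nu)$ is nested: there is a function $k:\bar Y\to\mathbb R$ with $\mu(X_\ge(y,k(y)))=\nu((-\infty,y])$ for all $y\in\bar Y$, and for every such $k$ and all $y_0<y_1$ in $\bar Y$ with $\nu([y_0,y_1])>0$, $$X_\ge(y_0,k(y_0))\subseteq X_>(y_1,k(y_1)).$$ (Here $\approx0.61$ means that the bound differs from $0.61$ by less than $0.005$.) -/

import Mathlib

open MeasureTheory Set

noncomputable section

namespace NestedOT

variable {E : Type*} [MeasurableSpace E]

/-- The level set `X_=(y, k)`: the points `x` of `X` with `∂c/∂y (x, y) = k`. -/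
def levelSet (X : Set E) (c : E → ℝ → ℝ) (y k : ℝ) : Set E :=
  {x | x ∈ X ∧ deriv (fun t => c x t) y = k}

/-- The super-level set `X_≥(y, k)`: the points `x` of `X` with `∂c/∂y (x, y) ≥ k`. -/
def superLevelSet (X : Set E) (c : E → ℝ → ℝ) (y k : ℝ) : Set E :=
  {x | x ∈ X ∧ k ≤ deriv (fun t => c x t) y}

/-- The strict super-level set `X_>(y, k) = X_≥(y, k) \ X_=(y, k)`. -/
def strictSuperLevelSet (X : Set E) (c : E → ℝ → ℝ) (y k : ℝ) : Set E :=
  superLevelSet X c y k \ levelSet X c y k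

/-- `k` splits the mass proportionately: `μ (X_≥(y, k y)) = ν ((-∞, y])` for every `y` in the
closure of `Y`. -/
def IsMassSplitting (X : Set E) (Y : Set ℝ) (c : E → ℝ → ℝ) (μ : Measure E) (ν : Measure ℝ)
    (k : ℝ → ℝ) : Prop :=
  ∀ y ∈ closure Y, μ (superLevelSet X c y (k y)) = ν (Iic y)

/-- The model `(c, μ, ν)` is nested: a mass splitting `k` exists, and for every choice of it (the
value `k y` may be non-unique where `ν ((-∞, y])` is `0` or `1`) the super-level sets
`X_≥(y, k y)` are strictly nested along `y₀ < y₁` with `ν ([y₀, y₁]) > 0`. -/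
def IsNested (X : Set E) (Y : Set ℝ) (c : E → ℝ → ℝ) (μ : Measure E) (ν : Measure ℝ) : Prop :=
  (∃ k : ℝ → ℝ, IsMassSplitting X Y c μ ν k) ∧
  ∀ k : ℝ → ℝ, IsMassSplitting X Y c μ ν k →
    ∀ y₀ ∈ closure Y, ∀ y₁ ∈ closure Y, y₀ < y₁ → 0 < ν (Icc y₀ y₁) →
      superLevelSet X c y₀ (k y₀) ⊆ strictSuperLevelSet X c y₁ (k y₁)

/-- `Π(μ, ν)`: the measures on the product with marginals `μ` and `ν`. -/
def couplings (μ : Measure E) (ν : Measure ℝ) : Set (Measure (E × ℝ)) :=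
  {γ | γ.fst = μ ∧ γ.snd = ν}

/-- The optimal transport cost `T_c(μ, ν) = inf { ∫ c dγ : γ ∈ Π(μ, ν) }`. It is meant for
probability measures and a cost that is measurable and bounded on the supports, so that all
integrals converge and the infimum is finite. -/
def transportCost (c : E → ℝ → ℝ) (μ : Measure E) (ν : Measure ℝ) : ℝ :=
  sInf ((fun γ : Measure (E × ℝ) => ∫ p, c p.1 p.2 ∂γ) '' couplings μ ν)

open Classical in
/-- The entropy `∫_Y ρ log ρ dy`, where `ρ` is the Lebesgue density of `ν`, with value `+∞` if `ν`
is not absolutely continuous. As `t log t` is bounded below, on a bounded `Y` the integral is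
`+∞` exactly when the integrand is not integrable. -/
def entropy (Y : Set ℝ) (ν : Measure ℝ) : EReal :=
  if ν ≪ volume ∧
      IntegrableOn (fun y => (ν.rnDeriv volume y).toReal * Real.log (ν.rnDeriv volume y).toReal) Y
  then ((∫ y in Y, (ν.rnDeriv volume y).toReal * Real.log (ν.rnDeriv volume y).toReal : ℝ) : EReal)
  else ⊤

/-- `P(S)`: the Borel probability measures on `ℝ` concentrated on `S`. -/
def probOn (S : Set ℝ) : Set (Measure ℝ) :=
  {ν | IsProbabilityMeasure ν ∧ ν Sᶜ = 0}

/-- `ν` minimizes `T_c(μ, ν) + F(ν)` over `P(closure Y)`, where `F` is the entropy on `Y`. -/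
def IsEntropicMinimizer (Y : Set ℝ) (c : E → ℝ → ℝ) (μ : Measure E) (ν : Measure ℝ) : Prop :=
  ν ∈ probOn (closure Y) ∧
  ∀ ν' ∈ probOn (closure Y),
    (transportCost c μ ν : EReal) + entropy Y ν ≤ (transportCost c μ ν' : EReal) + entropy Y ν'

/-- The open quarter disk `{x₁, x₂ > 0, x₁² + x₂² < 1}`. -/
def quarterDisk : Set (EuclideanSpace ℝ (Fin 2)) :=
  {x | 0 < x 0 ∧ 0 < x 1 ∧ x 0 ^ 2 + x 1 ^ 2 < 1}

/-- The uniform probability measure on the quarter disk, i.e. normalized Lebesgue measure. -/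
def quarterDiskUniform : Measure (EuclideanSpace ℝ (Fin 2)) :=
  (volume quarterDisk)⁻¹ • volume.restrict quarterDisk

/-- The cost `c(x, y) = - x · (cos y, sin y)`. -/
def arcCost (x : EuclideanSpace ℝ (Fin 2)) (y : ℝ) : ℝ :=
  -inner ℝ x !₂[Real.cos y, Real.sin y]

end NestedOT

end

namespace NestedOT

/-! Two rates of mass are compared. If nesting fails for y₀ < y₁, some z lies in X_≥(y₀, k y₀) but
not in X_>(y₁, k y₁). Every point of X_≥(y₁, k y₁) outside X_≥(y₀, k y₀) then lies in the wedge
swept by a line through z turning from angle y₀ to angle y₁, so mass splitting gives ν((y₀, y₁]) ≤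
μ(wedge). Translating z to the origin puts the wedge in a sector of the unit disk, and its μ-mass is
at most (2/π)(y₁ - y₀) (`volume_wedge_le`).

On the other side, minimality forces the density ρ of ν to be a.e. at least m for every m <
e^{-ȳ}/ȳ. This needs neither dual potentials nor an Euler-Lagrange equation: replacing ν by a
mixture with a fraction ε of the uniform law on {ρ < m} raises the transport cost by at most εȳ
(`transportCost_mix_le`), yet would lower the entropy by more than εȳ for small ε if that set had
positive measure (`ae_le_of_entropy_le_mix`). The bound on ȳ yields 2/π < e^{-ȳ}/ȳ
(`two_div_pi_lt`), so the two estimates are incompatible. -/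

theorem arcCost_eq (x : EuclideanSpace ℝ (Fin 2)) (y : ℝ) :
    arcCost x y = -(x 0 * Real.cos y + x 1 * Real.sin y) := by
  simp [arcCost, PiLp.inner_apply, Fin.sum_univ_two, mul_comm]

theorem hasDerivAt_arcCost (x : EuclideanSpace ℝ (Fin 2)) (y : ℝ) :
    HasDerivAt (arcCost x) (x 0 * Real.sin y - x 1 * Real.cos y) y := by
  rw [show arcCost x = fun t => -(x 0 * Real.cos t + x 1 * Real.sin t) from
    funext fun t => arcCost_eq x t]
  refine HasDerivAt.congr_deriv (((Real.hasDerivAt_cos y).const_mul (x 0)).fun_add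
    ((Real.hasDerivAt_sin y).const_mul (x 1))).fun_neg ?_
  ring

theorem deriv_arcCost (x : EuclideanSpace ℝ (Fin 2)) (y : ℝ) :
    deriv (fun t => arcCost x t) y = x 0 * Real.sin y - x 1 * Real.cos y :=
  (hasDerivAt_arcCost x y).deriv

/-! ### Areas of the quarter disk, sectors and wedges -/

theorem lintegral_polar_rect (T : Set ℝ) :
    ∫⁻ p in Ioo (0 : ℝ) 1 ×ˢ T, ENNReal.ofReal p.1 = volume T / 2 := by
  have h1 : ∫⁻ r in Ioo (0 : ℝ) 1, ENNReal.ofReal r = 1 / 2 := by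
    rw [← ofReal_integral_eq_lintegral_ofReal]
    · rw [← integral_Ioc_eq_integral_Ioo, ← intervalIntegral.integral_of_le zero_le_one]
      simp
    · exact (continuous_id.integrableOn_Icc (a := (0 : ℝ)) (b := 1)).mono_set Ioo_subset_Icc_self
    · exact (ae_restrict_mem measurableSet_Ioo).mono fun r hr => hr.1.le
  have h2 := lintegral_prod_mul (μ := volume.restrict (Ioo (0 : ℝ) 1)) (ν := volume.restrict T)
    (f := fun r : ℝ => ENNReal.ofReal r) (g := fun _ : ℝ => 1)
    ENNReal.measurable_ofReal.aemeasurable measurable_const.aemeasurable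
  rw [Measure.volume_eq_prod, ← Measure.prod_restrict]
  simpa [h1, ENNReal.div_eq_inv_mul] using h2

theorem volume_eq_lintegral_polar {S : Set (ℝ × ℝ)} (hS : MeasurableSet S) :
    volume S = ∫⁻ p in polarCoord.target ∩ polarCoord.symm ⁻¹' S, ENNReal.ofReal p.1 := by
  rw [← lintegral_indicator_one hS, ← lintegral_comp_polarCoord_symm, inter_comm,
    ← Measure.restrict_restrict (continuous_polarCoord_symm.measurable hS),
    ← lintegral_indicator (continuous_polarCoord_symm.measurable hS)]
  refine lintegral_congr fun p => ?_
  by_cases hp : polarCoord.symm p ∈ S <;>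
    simp only [indicator, mem_preimage, hp, if_true, if_false, Pi.one_apply, smul_eq_mul, mul_one,
      mul_zero]

theorem measurePreserving_coords :
    MeasurePreserving (fun x : EuclideanSpace ℝ (Fin 2) => (x 0, x 1)) :=
  (volume_preserving_finTwoArrow ℝ).comp (PiLp.volume_preserving_ofLp (Fin 2))

theorem isOpen_quarterDisk : IsOpen quarterDisk := by
  refine IsOpen.and ?_ (IsOpen.and ?_ ?_) <;> exact isOpen_lt (by fun_prop) (by fun_prop)

theorem measurableSet_sector (a b : ℝ) :
    MeasurableSet {p : ℝ × ℝ | p.1 ^ 2 + p.2 ^ 2 < 1 ∧ 0 ≤ p.1 * Real.sin b - p.2 * Real.cos b ∧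
      p.1 * Real.sin a - p.2 * Real.cos a < 0} := by
  rw [ofPred_and, ofPred_and]
  refine MeasurableSet.inter ?_ (MeasurableSet.inter ?_ ?_)
  · exact measurableSet_lt (by fun_prop) (by fun_prop)
  · exact measurableSet_le (by fun_prop) (by fun_prop)
  · exact measurableSet_lt (by fun_prop) (by fun_prop)

theorem volume_quarterDisk : volume quarterDisk = ENNReal.ofReal (Real.pi / 4) := by
  have hm : MeasurableSet {p : ℝ × ℝ | 0 < p.1 ∧ 0 < p.2 ∧ p.1 ^ 2 + p.2 ^ 2 < 1} := by
    refine IsOpen.measurableSet (IsOpen.and ?_ (IsOpen.and ?_ ?_)) <;>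
      exact isOpen_lt (by fun_prop) (by fun_prop)
  have h1 := measurePreserving_coords.measure_preimage hm.nullMeasurableSet
  have h2 : polarCoord.target ∩ polarCoord.symm ⁻¹'
      {p : ℝ × ℝ | 0 < p.1 ∧ 0 < p.2 ∧ p.1 ^ 2 + p.2 ^ 2 < 1} =
      Ioo 0 1 ×ˢ Ioo 0 (Real.pi / 2) := by
    ext ⟨r, φ⟩
    simp only [polarCoord_target, polarCoord_symm_apply, mem_inter_iff, mem_prod, mem_Ioi, mem_Ioo,
      mem_preimage, mem_ofPred_eq]
    have hr : (r * Real.cos φ) ^ 2 + (r * Real.sin φ) ^ 2 = r ^ 2 := by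
      linear_combination r ^ 2 * Real.cos_sq_add_sin_sq φ
    rw [hr]
    constructor
    · rintro ⟨⟨h0, h3, h4⟩, h5, h6, h7⟩
      have hc : 0 < Real.cos φ := pos_of_mul_pos_right h5 h0.le
      have hs : 0 < Real.sin φ := pos_of_mul_pos_right h6 h0.le
      refine ⟨⟨h0, by nlinarith⟩, ?_, ?_⟩
      · by_contra h
        exact absurd (Real.sin_nonpos_of_nonpos_of_neg_pi_le (not_lt.1 h) h3.le) (not_le.2 hs)
      · by_contra h
        exact absurd (Real.cos_nonpos_of_pi_div_two_le_of_le (not_lt.1 h)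
          (by linarith [Real.pi_pos])) (not_le.2 hc)
    · rintro ⟨⟨h0, h1⟩, h3, h4⟩
      refine ⟨⟨h0, by linarith, by linarith⟩, mul_pos h0 ?_, mul_pos h0 ?_, by nlinarith⟩
      · exact Real.cos_pos_of_mem_Ioo ⟨by linarith, h4⟩
      · exact Real.sin_pos_of_pos_of_lt_pi h3 (by linarith)
  rw [volume_eq_lintegral_polar hm, h2, lintegral_polar_rect, Real.volume_Ioo, sub_zero] at h1
  have h3 : quarterDisk = (fun x : EuclideanSpace ℝ (Fin 2) => (x 0, x 1)) ⁻¹'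
      {p : ℝ × ℝ | 0 < p.1 ∧ 0 < p.2 ∧ p.1 ^ 2 + p.2 ^ 2 < 1} := rfl
  rw [h3, h1, show (2 : ENNReal) = ENNReal.ofReal 2 by simp,
    ← ENNReal.ofReal_div_of_pos two_pos]
  congr 1
  ring

/-- A circular sector of radius `1` between the angles `a` and `b` has area `(b - a) / 2`. -/
theorem volume_sector_le {a b : ℝ} (ha : 0 ≤ a) (hab : a < b) (hb : b < Real.pi) :
    volume {p : ℝ × ℝ | p.1 ^ 2 + p.2 ^ 2 < 1 ∧ 0 ≤ p.1 * Real.sin b - p.2 * Real.cos b ∧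
      p.1 * Real.sin a - p.2 * Real.cos a < 0} ≤ ENNReal.ofReal ((b - a) / 2) := by
  rw [volume_eq_lintegral_polar]
  · refine (lintegral_mono_set (t := Ioo 0 1 ×ˢ Ioc a b) ?_).trans ?_
    · rintro ⟨r, φ⟩
      simp only [polarCoord_target, polarCoord_symm_apply, mem_inter_iff, mem_prod, mem_Ioi,
        mem_Ioo, mem_Ioc, mem_preimage, mem_ofPred_eq]
      rintro ⟨⟨h0, h3, h4⟩, h5, h6, h7⟩
      have hr : (r * Real.cos φ) ^ 2 + (r * Real.sin φ) ^ 2 = r ^ 2 := by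
        linear_combination r ^ 2 * Real.cos_sq_add_sin_sq φ
      have h6' : 0 ≤ r * Real.sin (b - φ) := by rw [Real.sin_sub]; linarith
      have h7' : r * Real.sin (a - φ) < 0 := by rw [Real.sin_sub]; linarith
      have hb' : 0 ≤ Real.sin (b - φ) := nonneg_of_mul_nonneg_right h6' h0
      have ha' : Real.sin (a - φ) < 0 := by
        by_contra h
        exact absurd (mul_nonneg h0.le (not_lt.1 h)) (not_le.2 h7')
      rw [hr] at h5
      have h8 : φ ≤ b := by
        by_contra! h
        exact absurd (Real.sin_neg_of_neg_of_neg_pi_lt (by linarith) (by linarith : -Real.pi < b - φ))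
          (not_lt.2 hb')
      refine ⟨⟨h0, by nlinarith⟩, ?_, h8⟩
      -- If φ ≤ a, then sin (a - φ) < 0 forces a - φ > π, and b - φ lies in (π, 2π), where the sine
      -- is negative.
      by_contra! h
      rcases le_or_gt (a - φ) Real.pi with h9 | h9
      · exact absurd (Real.sin_nonneg_of_nonneg_of_le_pi (by linarith) h9) (not_le.2 ha')
      · have : 0 < Real.sin ((b - φ) - Real.pi) :=
          Real.sin_pos_of_pos_of_lt_pi (by linarith) (by linarith)
        rw [Real.sin_sub_pi] at this
        linarith
    · rw [lintegral_polar_rect, Real.volume_Ioc, show (2 : ENNReal) = ENNReal.ofReal 2 by simp,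
        ← ENNReal.ofReal_div_of_pos two_pos]
  · exact measurableSet_sector a b

/-- The part of the quarter disk swept by a line pivoting at `z` from angle `a` to angle `b`. -/
theorem volume_wedge_le {z : EuclideanSpace ℝ (Fin 2)} (hz : z ∈ quarterDisk) {a b : ℝ}
    (ha : 0 ≤ a) (hab : a < b) (hb : b ≤ Real.pi / 2) :
    volume {x | x ∈ quarterDisk ∧
      z 0 * Real.sin b - z 1 * Real.cos b ≤ x 0 * Real.sin b - x 1 * Real.cos b ∧
      x 0 * Real.sin a - x 1 * Real.cos a < z 0 * Real.sin a - z 1 * Real.cos a} ≤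
      ENNReal.ofReal ((b - a) / 2) := by
  refine le_trans ?_ (volume_sector_le ha hab (by linarith [Real.pi_pos]))
  set S := {p : ℝ × ℝ | p.1 ^ 2 + p.2 ^ 2 < 1 ∧ 0 ≤ p.1 * Real.sin b - p.2 * Real.cos b ∧
      p.1 * Real.sin a - p.2 * Real.cos a < 0} with hS
  have hSm : MeasurableSet S := measurableSet_sector a b
  have h1 := measure_preimage_add_right (volume : Measure (ℝ × ℝ)) (-(z 0, z 1)) S
  have hSm' : MeasurableSet ((fun p : ℝ × ℝ => p + -(z 0, z 1)) ⁻¹' S) :=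
    (measurable_add_const _) hSm
  rw [← h1, ← measurePreserving_coords.measure_preimage hSm'.nullMeasurableSet]
  refine measure_mono ?_
  rintro x ⟨⟨hx0, hx1, hx⟩, hxb, hxa⟩
  obtain ⟨hz0, hz1, hz2⟩ := hz
  have hsb : 0 < Real.sin b := Real.sin_pos_of_pos_of_lt_pi (by linarith) (by linarith [Real.pi_pos])
  have hcb : 0 ≤ Real.cos b := Real.cos_nonneg_of_neg_pi_div_two_le_of_le (by linarith) hb
  have hca : 0 < Real.cos a := Real.cos_pos_of_mem_Ioo ⟨by linarith [Real.pi_pos], by linarith⟩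
  have hsa : 0 ≤ Real.sin a := Real.sin_nonneg_of_nonneg_of_le_pi ha (by linarith [Real.pi_pos])
  have hs : 0 < Real.sin (b - a) :=
    Real.sin_pos_of_pos_of_lt_pi (by linarith) (by linarith [Real.pi_pos])
  rw [Real.sin_sub] at hs
  -- Directions between a and b lie in the first quadrant, so x - z has nonnegative coordinates;
  -- each follows by eliminating the other from the two half-plane conditions, with determinant sin
  -- (b - a) > 0. As z itself is positive, |x - z| ≤ |x| < 1.
  have h0 : z 0 ≤ x 0 := by
    have : 0 ≤ (x 0 - z 0) * (Real.sin b * Real.cos a - Real.cos b * Real.sin a) := by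
      nlinarith [mul_le_mul_of_nonneg_left hxb hca.le, mul_le_mul_of_nonneg_left hxa.le hcb]
    linarith [nonneg_of_mul_nonneg_left this hs]
  have h2 : z 1 ≤ x 1 := by
    have : 0 ≤ (x 1 - z 1) * (Real.sin b * Real.cos a - Real.cos b * Real.sin a) := by
      nlinarith [mul_le_mul_of_nonneg_left hxb hsa, mul_le_mul_of_nonneg_left hxa.le hsb.le]
    linarith [nonneg_of_mul_nonneg_left this hs]
  simp only [hS, mem_preimage, mem_ofPred_eq, Prod.fst_add, Prod.snd_add, Prod.fst_neg, Prod.snd_neg]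
  exact ⟨by nlinarith, by linarith, by linarith⟩

/-! ### The uniform measure and bounds on the cost -/

instance isProbabilityMeasure_quarterDiskUniform :
    IsProbabilityMeasure quarterDiskUniform := by
  constructor
  rw [quarterDiskUniform, Measure.smul_apply, Measure.restrict_apply_univ, smul_eq_mul,
    ENNReal.inv_mul_cancel]
  · rw [volume_quarterDisk, Ne, ENNReal.ofReal_eq_zero, not_le]
    positivity
  · rw [volume_quarterDisk]
    exact ENNReal.ofReal_ne_top

theorem ae_mem_quarterDisk : ∀ᵐ x ∂quarterDiskUniform, x ∈ quarterDisk :=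
  Measure.ae_smul_measure (ae_restrict_mem isOpen_quarterDisk.measurableSet) _

theorem abs_deriv_arcCost_le {x : EuclideanSpace ℝ (Fin 2)} (hx : x ∈ quarterDisk) (y : ℝ) :
    |x 0 * Real.sin y - x 1 * Real.cos y| ≤ 1 := by
  obtain ⟨-, -, h⟩ := hx
  refine abs_le_of_sq_le_sq (a := x 0 * Real.sin y - x 1 * Real.cos y) ?_ zero_le_one
  nlinarith [sq_nonneg (x 0 * Real.cos y + x 1 * Real.sin y), Real.sin_sq_add_cos_sq y]

theorem abs_arcCost_sub_le {x : EuclideanSpace ℝ (Fin 2)} (hx : x ∈ quarterDisk) (y z : ℝ) :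
    |arcCost x y - arcCost x z| ≤ |y - z| := by
  have := convex_univ.norm_image_sub_le_of_norm_hasDerivWithin_le (f := arcCost x) (x := z) (y := y)
    (fun t _ => (hasDerivAt_arcCost x t).hasDerivWithinAt)
    (fun t _ => abs_deriv_arcCost_le hx t) (mem_univ z) (mem_univ y)
  simpa using this

theorem continuous_arcCost :
    Continuous fun p : EuclideanSpace ℝ (Fin 2) × ℝ => arcCost p.1 p.2 := by
  simp only [arcCost_eq]
  fun_prop

theorem abs_arcCost_le {x : EuclideanSpace ℝ (Fin 2)} (hx : x ∈ quarterDisk) (y : ℝ) :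
    |arcCost x y| ≤ 1 := by
  obtain ⟨-, -, h⟩ := hx
  rw [arcCost_eq, abs_neg]
  refine abs_le_of_sq_le_sq (a := x 0 * Real.cos y + x 1 * Real.sin y) ?_ zero_le_one
  nlinarith [sq_nonneg (x 0 * Real.sin y - x 1 * Real.cos y), Real.sin_sq_add_cos_sq y]

/-! ### Couplings and the transport cost of mixtures -/

section Coupling

variable {γ : Measure (EuclideanSpace ℝ (Fin 2) × ℝ)} {ν : Measure ℝ}

theorem isProbabilityMeasure_of_mem_couplings (hγ : γ ∈ couplings quarterDiskUniform ν) :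
    IsProbabilityMeasure γ := by
  constructor
  rw [← Measure.fst_univ, hγ.1, measure_univ]

theorem ae_mem_quarterDisk_of_mem_couplings (hγ : γ ∈ couplings quarterDiskUniform ν) :
    ∀ᵐ p ∂γ, p.1 ∈ quarterDisk := by
  have h := ae_mem_quarterDisk
  rw [← hγ.1] at h
  exact ae_of_ae_map measurable_fst.aemeasurable h

theorem integrable_arcCost (hγ : γ ∈ couplings quarterDiskUniform ν) :
    Integrable (fun p => arcCost p.1 p.2) γ := by
  have := isProbabilityMeasure_of_mem_couplings hγ
  exact Integrable.of_bound continuous_arcCost.aestronglyMeasurable 1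
    ((ae_mem_quarterDisk_of_mem_couplings hγ).mono fun p hp => abs_arcCost_le hp p.2)

/-- Every transport plan to `[0, b]` costs about as much as moving all mass to the midpoint. -/
theorem abs_integral_arcCost_sub_le {b : ℝ} (hν : ν ∈ probOn (Icc 0 b))
    (hγ : γ ∈ couplings quarterDiskUniform ν) :
    |(∫ p, arcCost p.1 p.2 ∂γ) - ∫ x, arcCost x (b / 2) ∂quarterDiskUniform| ≤ b / 2 := by
  have := isProbabilityMeasure_of_mem_couplings hγ
  have hm : Continuous fun x => arcCost x (b / 2) := by
    simp only [arcCost_eq]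
    fun_prop
  have h1 : ∫ x, arcCost x (b / 2) ∂quarterDiskUniform = ∫ p, arcCost p.1 (b / 2) ∂γ := by
    rw [← hγ.1, Measure.fst, integral_map measurable_fst.aemeasurable hm.aestronglyMeasurable]
  have h2 : ∀ᵐ p ∂γ, p.2 ∈ Icc 0 b := by
    have h : ∀ᵐ y ∂ν, y ∈ Icc 0 b := hν.2
    rw [← hγ.2] at h
    exact ae_of_ae_map measurable_snd.aemeasurable h
  have h3 : Integrable (fun p : EuclideanSpace ℝ (Fin 2) × ℝ => arcCost p.1 (b / 2)) γ :=
    Integrable.of_bound (hm.comp continuous_fst).aestronglyMeasurable 1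
      ((ae_mem_quarterDisk_of_mem_couplings hγ).mono fun p hp => abs_arcCost_le hp _)
  rw [h1, ← integral_sub (integrable_arcCost hγ) h3]
  have h4 : ∀ᵐ p ∂γ, ‖arcCost p.1 p.2 - arcCost p.1 (b / 2)‖ ≤ b / 2 := by
    filter_upwards [ae_mem_quarterDisk_of_mem_couplings hγ, h2] with p hp hp2
    refine (abs_arcCost_sub_le hp _ _).trans (abs_le.2 ⟨?_, ?_⟩) <;> linarith [hp2.1, hp2.2]
  simpa using norm_integral_le_of_norm_le_const h4

end Coupling

theorem prod_mem_couplings (ν : Measure ℝ) [IsProbabilityMeasure ν] :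
    quarterDiskUniform.prod ν ∈ couplings quarterDiskUniform ν :=
  ⟨Measure.fst_prod, Measure.snd_prod⟩

theorem add_mem_couplings {E : Type*} [MeasurableSpace E] {μ μ' : Measure E} {ν ν' : Measure ℝ}
    {γ γ' : Measure (E × ℝ)} (h : γ ∈ couplings μ ν) (h' : γ' ∈ couplings μ' ν') :
    γ + γ' ∈ couplings (μ + μ') (ν + ν') := by
  refine ⟨?_, ?_⟩
  · rw [Measure.fst, Measure.map_add _ _ measurable_fst, ← Measure.fst, ← Measure.fst, h.1, h'.1]
  · rw [Measure.snd, Measure.map_add _ _ measurable_snd, ← Measure.snd, ← Measure.snd, h.2, h'.2]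

theorem smul_mem_couplings {E : Type*} [MeasurableSpace E] {μ : Measure E} {ν : Measure ℝ}
    {γ : Measure (E × ℝ)} (r : ENNReal) (h : γ ∈ couplings μ ν) :
    r • γ ∈ couplings (r • μ) (r • ν) := by
  refine ⟨?_, ?_⟩
  · rw [Measure.fst, Measure.map_smul, ← Measure.fst, h.1]
  · rw [Measure.snd, Measure.map_smul, ← Measure.snd, h.2]

theorem add_smul_mem_probOn {S : Set ℝ} {ν σ : Measure ℝ} (hν : ν ∈ probOn S) (hσ : σ ∈ probOn S)
    {ε : ℝ} (h0 : 0 ≤ ε) (h1 : ε ≤ 1) :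
    ENNReal.ofReal (1 - ε) • ν + ENNReal.ofReal ε • σ ∈ probOn S := by
  obtain ⟨_, hν⟩ := hν
  obtain ⟨_, hσ⟩ := hσ
  refine ⟨⟨?_⟩, by simp [hν, hσ]⟩
  simp only [Measure.add_apply, Measure.smul_apply, measure_univ, smul_eq_mul, mul_one]
  rw [← ENNReal.ofReal_add (by linarith) h0]
  simp

/-- Given a plan γ for ν, the competitor is (1 - ε)γ + ε(μ ⊗ σ). Both γ and μ ⊗ σ cost within b / 2
of sending all mass to the midpoint, so the exchange costs at most εb. -/
theorem transportCost_mix_le {b : ℝ} {ν σ : Measure ℝ} (hν : ν ∈ probOn (Icc 0 b))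
    (hσ : σ ∈ probOn (Icc 0 b)) {ε : ℝ} (h0 : 0 ≤ ε) (h1 : ε ≤ 1) :
    transportCost arcCost quarterDiskUniform (ENNReal.ofReal (1 - ε) • ν + ENNReal.ofReal ε • σ) ≤
      transportCost arcCost quarterDiskUniform ν + ε * b := by
  rw [← sub_le_iff_le_add]
  have := hν.1
  have := hσ.1
  refine le_csInf ⟨_, mem_image_of_mem _ (prod_mem_couplings ν)⟩ ?_
  rintro _ ⟨γ, hγ, rfl⟩
  have hπ := prod_mem_couplings σ
  have hmem : ENNReal.ofReal (1 - ε) • γ + ENNReal.ofReal ε • quarterDiskUniform.prod σ ∈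
      couplings quarterDiskUniform (ENNReal.ofReal (1 - ε) • ν + ENNReal.ofReal ε • σ) := by
    have h := add_mem_couplings (smul_mem_couplings (ENNReal.ofReal (1 - ε)) hγ)
      (smul_mem_couplings (ENNReal.ofReal ε) hπ)
    rwa [← add_smul, ← ENNReal.ofReal_add (by linarith) h0, sub_add_cancel, ENNReal.ofReal_one,
      one_smul] at h
  -- Required because a real `sInf` is a lower bound only for sets bounded below.
  have hbdd : BddBelow ((fun γ : Measure (EuclideanSpace ℝ (Fin 2) × ℝ) =>
      ∫ p, arcCost p.1 p.2 ∂γ) '' couplings quarterDiskUniform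
        (ENNReal.ofReal (1 - ε) • ν + ENNReal.ofReal ε • σ)) := by
    refine ⟨(∫ x, arcCost x (b / 2) ∂quarterDiskUniform) - b / 2, ?_⟩
    rintro _ ⟨γ', hγ', rfl⟩
    have := (abs_le.1 (abs_integral_arcCost_sub_le (add_smul_mem_probOn hν hσ h0 h1) hγ')).1
    simp only
    linarith
  have hle := csInf_le hbdd (mem_image_of_mem _ hmem)
  have hval : ∫ p, arcCost p.1 p.2 ∂(ENNReal.ofReal (1 - ε) • γ +
      ENNReal.ofReal ε • quarterDiskUniform.prod σ) = (1 - ε) * (∫ p, arcCost p.1 p.2 ∂γ) +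
      ε * ∫ p, arcCost p.1 p.2 ∂(quarterDiskUniform.prod σ) := by
    rw [integral_add_measure ((integrable_arcCost hγ).smul_measure ENNReal.ofReal_ne_top)
      ((integrable_arcCost hπ).smul_measure ENNReal.ofReal_ne_top), integral_smul_measure,
      integral_smul_measure, ENNReal.toReal_ofReal (by linarith), ENNReal.toReal_ofReal h0]
    simp
  simp only [hval] at hle
  have h2 := (abs_le.1 (abs_integral_arcCost_sub_le hν hγ)).1
  have h3 := (abs_le.1 (abs_integral_arcCost_sub_le hσ hπ)).2
  rw [transportCost]
  simp only
  nlinarith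

/-! ### Entropy estimates and the lower bound on the density -/

/-- The convex function t log t lies above its tangent at s. -/
theorem tangent_le_mul_log {s t : ℝ} (hs : 0 < s) (ht : 0 ≤ t) :
    t * (1 + Real.log s) - s ≤ t * Real.log t := by
  rcases ht.eq_or_lt with rfl | ht
  · simpa using hs.le
  · have h := Real.log_le_sub_one_of_pos (div_pos hs ht)
    rw [Real.log_div hs.ne' ht.ne'] at h
    have h2 := mul_le_mul_of_nonneg_left h ht.le
    have h3 : t * (s / t - 1) = s - t := by field_simp
    rw [h3] at h2
    linarith

/-- Entropy change where mass is added: the tangent is taken at the new value a. -/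
theorem mul_log_mix_sub_le {a r d M : ℝ} (hr : 0 ≤ r) (hd : 0 ≤ d) (ha : a = r + d) (ha0 : 0 < a)
    (haM : a ≤ M) : a * Real.log a - r * Real.log r ≤ (1 + Real.log M) * d := by
  have h := tangent_le_mul_log ha0 hr
  have h2 := mul_le_mul_of_nonneg_right (Real.log_le_log ha0 haM) hd
  subst ha
  linarith

/-- Entropy change where the density is only scaled down. The tangent is taken at the uniform
density 1/b, so the bound is affine in r and can be integrated explicitly. -/
theorem mul_log_scale_sub_le {r ε b : ℝ} (hb : 0 < b) (hr : 0 < r) (h0 : 0 ≤ ε) (h1 : ε < 1) :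
    (1 - ε) * r * Real.log ((1 - ε) * r) - r * Real.log r ≤
      ε * (b⁻¹ - r * (2 - ε - Real.log b)) := by
  have h := tangent_le_mul_log (inv_pos.2 hb) hr.le
  rw [Real.log_inv] at h
  rw [Real.log_mul (by linarith) hr.ne']
  have h2 := Real.log_le_sub_one_of_pos (by linarith : 0 < 1 - ε)
  have h3 := mul_le_mul_of_nonneg_left h2 (by nlinarith : 0 ≤ (1 - ε) * r)
  have h4 := mul_le_mul_of_nonneg_left h h0
  nlinarith

/-- A density that cannot lower its entropy by more than the transport cost `ε * b` when mixed with
`ε` times a uniform density is bounded below. -/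
theorem ae_le_of_entropy_le_mix {b m : ℝ} (hb : 0 < b) {ρ : ℝ → ℝ} (hρm : Measurable ρ)
    (hρ0 : ∀ y, 0 ≤ ρ y) (hint : IntegrableOn ρ (Ioo 0 b)) (hone : ∫ y in Ioo 0 b, ρ y = 1)
    (hlog : IntegrableOn (fun y => ρ y * Real.log (ρ y)) (Ioo 0 b))
    (hm0 : 0 < m) (hm : m < Real.exp (-b) / b)
    (hmin : ∀ A ⊆ Ioo 0 b, MeasurableSet A → 0 < volume.real A → ∀ ε, 0 < ε → ε < 1 →
      ∀ a : ℝ → ℝ, (∀ y, a y = (1 - ε) * ρ y + ε * A.indicator (fun _ => (volume.real A)⁻¹) y) →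
      IntegrableOn (fun y => a y * Real.log (a y)) (Ioo 0 b) →
      ∫ y in Ioo 0 b, ρ y * Real.log (ρ y) ≤ (∫ y in Ioo 0 b, a y * Real.log (a y)) + ε * b) :
    ∀ᵐ y ∂volume.restrict (Ioo 0 b), m ≤ ρ y := by
  have hA : MeasurableSet (Ioo 0 b ∩ {y | ρ y < m}) :=
    measurableSet_Ioo.inter (measurableSet_lt hρm measurable_const)
  have hAI : Ioo 0 b ∩ {y | ρ y < m} ⊆ Ioo 0 b := inter_subset_left
  have hAρ : ∀ y ∈ Ioo 0 b ∩ {y | ρ y < m}, ρ y < m := fun y hy => hy.2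
  have hAc : ∀ y ∈ Ioo 0 b, y ∉ Ioo 0 b ∩ {y | ρ y < m} → m ≤ ρ y :=
    fun y hy h => not_lt.1 fun h' => h ⟨hy, h'⟩
  generalize Ioo 0 b ∩ {y | ρ y < m} = A at hA hAI hAρ hAc
  have hfin : volume A ≠ ⊤ := ne_top_of_le_ne_top (by simp) (measure_mono hAI)
  suffices hα : volume.real A = 0 by
    have hA0 : ∀ᵐ y, y ∉ A := measure_eq_zero_iff_ae_notMem.1
      ((measureReal_eq_zero_iff hfin).1 hα)
    filter_upwards [ae_restrict_mem measurableSet_Ioo, ae_restrict_of_ae hA0] with y hy hyA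
    exact hAc y hy hyA
  by_contra hα
  replace hα : 0 < volume.real A := lt_of_le_of_ne measureReal_nonneg (Ne.symm hα)
  set α := volume.real A with hαdef
  have hαb : α ≤ b := by
    have := measureReal_mono hAI (μ := volume) (by simp)
    simpa [hb.le] using this
  have hmb : m * b < Real.exp (-b) := (lt_div_iff₀ hb).1 hm
  have hexp : (1 + b) * Real.exp (-b) ≤ 1 := by
    rw [Real.exp_neg, ← div_eq_mul_inv, div_le_one (Real.exp_pos b)]
    linarith [Real.add_one_le_exp b]
  -- This strict gap, a consequence of (1 + b)e^{-b} ≤ 1, is what finally contradicts minimality.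
  have hgap : m * (1 + b) < b⁻¹ := by
    rw [lt_inv_comm₀ (by positivity) hb, lt_inv_comm₀ hb (by positivity), ← one_div,
      lt_div_iff₀ hb]
    nlinarith
  -- The second bound on ε keeps the mixed density below e^{-b}/b on A; the third makes ε smaller
  -- than the gap `hgap` scaled by α.
  obtain ⟨ε, hε0, hε⟩ : ∃ ε, 0 < ε ∧
      ε < min 1 (min (α * (Real.exp (-b) / b - m)) (α * (b⁻¹ - m * (1 + b)))) :=
    exists_between (lt_min one_pos (lt_min (mul_pos hα (by linarith)) (mul_pos hα (by linarith))))
  rw [lt_min_iff, lt_min_iff] at hε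
  obtain ⟨hε1, hε2, hε3⟩ := hε
  set M := Real.exp (-b) / b with hM
  have hlogM : Real.log M = -b - Real.log b := by
    rw [hM, Real.log_div (Real.exp_pos _).ne' hb.ne', Real.log_exp]
  have hMb : m * α < 1 := by
    have : Real.exp (-b) < 1 := by simpa using hb
    nlinarith
  have hmα : m < α⁻¹ := by rwa [← one_div, lt_div_iff₀ hα]
  have hε2' : m + ε * α⁻¹ < M := by
    have := mul_lt_mul_of_pos_right hε2 (inv_pos.2 hα)
    rw [mul_comm α, mul_assoc, mul_inv_cancel₀ hα.ne'] at this
    linarith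
  obtain ⟨a, ha⟩ : ∃ a : ℝ → ℝ,
      ∀ y, a y = (1 - ε) * ρ y + ε * A.indicator (fun _ => α⁻¹) y := ⟨_, fun _ => rfl⟩
  have haA : ∀ y ∈ A, a y = ρ y + ε * (α⁻¹ - ρ y) := fun y hy => by
    rw [ha, indicator_of_mem hy]; ring
  have haAc : ∀ y ∉ A, a y = (1 - ε) * ρ y := fun y hy => by
    rw [ha, indicator_of_notMem hy]; ring
  have ha0 : ∀ y ∈ A, 0 < a y := fun y hy => by
    rw [haA y hy]
    have := mul_pos hε0 (sub_pos.2 ((hAρ y hy).trans hmα))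
    linarith [hρ0 y]
  have haM : ∀ y ∈ A, a y ≤ M := fun y hy => by
    rw [haA y hy]
    nlinarith [hρ0 y, hAρ y hy]
  have ham : Measurable a := by
    rw [show a = fun y => (1 - ε) * ρ y + ε * A.indicator (fun _ => α⁻¹) y from funext ha]
    exact (hρm.const_mul _).add ((measurable_const.indicator hA).const_mul _)
  have hintA : IntegrableOn (fun y => a y * Real.log (a y)) A := by
    obtain ⟨C, hC⟩ := (isCompact_Icc (a := 0) (b := M)).exists_bound_of_continuousOn
      Real.continuous_mul_log.continuousOn
    refine Measure.integrableOn_of_bounded (M := C) hfin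
      (ham.mul (Real.measurable_log.comp ham)).aestronglyMeasurable ?_
    exact (ae_restrict_mem hA).mono fun y hy => hC _ ⟨(ha0 y hy).le, haM y hy⟩
  have hintAc : IntegrableOn (fun y => a y * Real.log (a y)) (Ioo 0 b \ A) := by
    have h := IntegrableOn.mono_set ((hint.const_mul ((1 - ε) * Real.log (1 - ε))).add
      (hlog.const_mul (1 - ε))) (sdiff_subset (s := Ioo 0 b) (t := A))
    refine h.congr_fun (fun y hy => ?_) (measurableSet_Ioo.diff hA)
    have hy0 : 0 < ρ y := hm0.trans_le (hAc y hy.1 hy.2)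
    simp only [Pi.add_apply, haAc y hy.2]
    rw [Real.log_mul (by linarith) hy0.ne']
    ring
  have hinta : IntegrableOn (fun y => a y * Real.log (a y)) (Ioo 0 b) := by
    have := hintA.union hintAc
    rwa [union_sdiff_cancel hAI] at this
  have hkey := hmin A hAI hA hα ε hε0 hε1 a ha hinta
  have hi1 : IntegrableOn (A.indicator fun _ => (1 : ℝ)) (Ioo 0 b) :=
    (integrableOn_const (by simp)).indicator hA
  have hiρ : IntegrableOn (A.indicator ρ) (Ioo 0 b) := hint.indicator hA
  have hIA : ∫ y in Ioo 0 b, A.indicator (fun _ => (1 : ℝ)) y = α := by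
    rw [setIntegral_indicator hA, inter_eq_self_of_subset_right hAI]
    simp [hαdef]
  obtain ⟨p, hp⟩ : ∃ p, p = ∫ y in Ioo 0 b, A.indicator ρ y := ⟨_, rfl⟩
  have hp0 : 0 ≤ p := hp ▸ integral_nonneg fun y => indicator_nonneg (fun y _ => hρ0 y) y
  have hpm : p ≤ m * α := by
    rw [← hIA, ← integral_const_mul, hp]
    refine integral_mono hiρ (hi1.const_mul m) fun y => ?_
    by_cases hy : y ∈ A
    · simpa [hy] using (hAρ y hy).le
    · simp [hy]
  have hi2 : IntegrableOn (fun _ : ℝ => (1 : ℝ)) (Ioo 0 b) := integrableOn_const (by simp)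
  have hdiff : (∫ y in Ioo 0 b, a y * Real.log (a y)) - ∫ y in Ioo 0 b, ρ y * Real.log (ρ y) ≤
      ε * ((1 - b - Real.log b) * (1 - p) + b⁻¹ * (b - α) - (2 - ε - Real.log b) * (1 - p)) := by
    -- One integrand majorizes the entropy change everywhere: on A only its first term survives, off
    -- A only the other two. Here p is the ν-mass of A.
    have hg : ∫ y in Ioo 0 b, ε * ((1 - b - Real.log b) *
          (α⁻¹ * A.indicator (fun _ => (1 : ℝ)) y - A.indicator ρ y) +
          b⁻¹ * (1 - A.indicator (fun _ => (1 : ℝ)) y) -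
          (2 - ε - Real.log b) * (ρ y - A.indicator ρ y)) =
        ε * ((1 - b - Real.log b) * (1 - p) + b⁻¹ * (b - α) - (2 - ε - Real.log b) * (1 - p)) := by
      have hI1 : ∫ y in Ioo 0 b, (1 : ℝ) = b := by simp [hb.le]
      rw [integral_const_mul, integral_sub, integral_add, integral_const_mul, integral_const_mul,
        integral_const_mul, integral_sub, integral_sub, integral_sub, integral_const_mul, hIA,
        ← hp, hone, hI1, inv_mul_cancel₀ hα.ne']
      exacts [hint, hiρ, hi2, hi1, hi1.const_mul _, hiρ, ((hi1.const_mul _).sub hiρ).const_mul _,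
        (hi2.sub hi1).const_mul _, (((hi1.const_mul _).sub hiρ).const_mul _).add
        ((hi2.sub hi1).const_mul _), (hint.sub hiρ).const_mul _]
    rw [← integral_sub hinta hlog, ← hg]
    refine setIntegral_mono_on (hinta.sub hlog) ?_ measurableSet_Ioo fun y hy => ?_
    · exact (((((hi1.const_mul _).sub hiρ).const_mul _).add
        ((hi2.sub hi1).const_mul _)).sub ((hint.sub hiρ).const_mul _)).const_mul _
    · by_cases hyA : y ∈ A
      · have h := mul_log_mix_sub_le (hρ0 y)
          (mul_nonneg hε0.le (sub_nonneg.2 ((hAρ y hyA).trans hmα).le))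
          (haA y hyA) (ha0 y hyA) (haM y hyA)
        rw [hlogM] at h
        simp only [indicator_of_mem hyA]
        linarith
      · have h := mul_log_scale_sub_le hb (hm0.trans_le (hAc y hy hyA)) hε0.le hε1
        simp only [indicator_of_notMem hyA, haAc y hyA]
        linarith
  -- The terms in log b cancel, leaving α/b ≤ ε(1 - p) + p(1 + b). With p ≤ mα this contradicts the
  -- choice of ε.
  have hpos : 0 ≤ ε * (b + ((1 - b - Real.log b) * (1 - p) + b⁻¹ * (b - α) -
      (2 - ε - Real.log b) * (1 - p))) := by linarith
  have hpos' := nonneg_of_mul_nonneg_right hpos hε0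
  rw [mul_sub b⁻¹, inv_mul_cancel₀ hb.ne'] at hpos'
  nlinarith [mul_le_mul_of_nonneg_right hpm (by linarith : 0 ≤ 1 + b), mul_nonneg hε0.le hp0]

theorem entropy_withDensity {Y : Set ℝ} {f : ℝ → ℝ} (hf : Measurable f) (hf0 : ∀ y, 0 ≤ f y)
    (hint : IntegrableOn (fun y => f y * Real.log (f y)) Y) :
    entropy Y (volume.withDensity fun y => ENNReal.ofReal (f y)) =
      ((∫ y in Y, f y * Real.log (f y) : ℝ) : EReal) := by
  have h : (fun y => ((volume.withDensity fun y => ENNReal.ofReal (f y)).rnDeriv volume y).toReal *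
      Real.log ((volume.withDensity fun y => ENNReal.ofReal (f y)).rnDeriv volume y).toReal)
      =ᵐ[volume] fun y => f y * Real.log (f y) := by
    filter_upwards [Measure.rnDeriv_withDensity volume hf.ennreal_ofReal] with y hy
    rw [hy, ENNReal.toReal_ofReal (hf0 y)]
  rw [entropy, if_pos ⟨withDensity_absolutelyContinuous _ _,
    hint.congr (ae_restrict_of_ae h.symm)⟩, integral_congr_ae (ae_restrict_of_ae h)]

/-! ### The threshold on ȳ -/

theorem abs_log_sub_lt :
    |Real.log ((1 + Real.sqrt (1 + 2 * Real.pi)) / 2) - 0.61| < 0.005 := by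
  have hp1 := Real.pi_gt_d6
  have hp2 := Real.pi_lt_d6
  have hs1 : 2.6987 < Real.sqrt (1 + 2 * Real.pi) := Real.lt_sqrt_of_sq_lt (by norm_num; linarith)
  have hs2 : Real.sqrt (1 + 2 * Real.pi) < 2.6988 := (Real.sqrt_lt' (by norm_num)).2 (by norm_num; linarith)
  rw [abs_sub_lt_iff]
  constructor
  · have : Real.log ((1 + Real.sqrt (1 + 2 * Real.pi)) / 2) < 0.615 := by
      rw [Real.log_lt_iff_lt_exp (by linarith)]
      have h := Real.sum_le_exp_of_nonneg (x := 0.615) (by norm_num) 7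
      norm_num [Finset.sum_range_succ, Nat.factorial] at h
      norm_num
      linarith
    linarith
  · have : 0.605 < Real.log ((1 + Real.sqrt (1 + 2 * Real.pi)) / 2) := by
      rw [Real.lt_log_iff_exp_lt (by linarith)]
      have h := Real.exp_bound' (x := 0.605) (by norm_num) (by norm_num) (n := 6) (by norm_num)
      norm_num [Finset.sum_range_succ, Nat.factorial] at h
      norm_num
      linarith
    linarith

/-- The number s = (1 + √(1 + 2π))/2 is the positive root of s(s - 1) = π/2. Since b < e^b - 1 and
e^b ≤ s, it follows that b e^b < s(s - 1) = π/2. -/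
theorem two_div_pi_lt {b : ℝ} (hb : 0 < b)
    (h : b ≤ Real.log ((1 + Real.sqrt (1 + 2 * Real.pi)) / 2)) :
    2 / Real.pi < Real.exp (-b) / b := by
  have hp := Real.pi_pos
  have hs := Real.sq_sqrt (by positivity : 0 ≤ 1 + 2 * Real.pi)
  have hs0 := Real.sqrt_nonneg (1 + 2 * Real.pi)
  have he : Real.exp b ≤ (1 + Real.sqrt (1 + 2 * Real.pi)) / 2 :=
    (Real.le_log_iff_exp_le (by positivity)).1 h
  have h1 := Real.add_one_lt_exp hb.ne'
  rw [Real.exp_neg, ← one_div, div_div, div_lt_div_iff₀ hp (by positivity)]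
  nlinarith [Real.exp_pos b]

/-! ### Mass of intervals under a minimizer -/

theorem ofReal_mul_le_measure_Ioc_of_isEntropicMinimizer {b m : ℝ} (hb : 0 < b) (hm0 : 0 < m)
    (hm : m < Real.exp (-b) / b) {ν : Measure ℝ}
    (hν : IsEntropicMinimizer (Ioo 0 b) arcCost quarterDiskUniform ν) {y₀ y₁ : ℝ} (h0 : 0 ≤ y₀)
    (h1 : y₁ ≤ b) : ENNReal.ofReal (m * (y₁ - y₀)) ≤ ν (Ioc y₀ y₁) := by
  obtain ⟨hmem, hmin⟩ := hν
  rw [closure_Ioo hb.ne] at hmem hmin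
  have hνp := hmem.1
  have uniform_mem : ∀ A ⊆ Ioo 0 b, MeasurableSet A → 0 < volume.real A →
      volume.withDensity (fun y => ENNReal.ofReal (A.indicator (fun _ => (volume.real A)⁻¹) y)) ∈
        probOn (Icc 0 b) := by
    intro A hA hAm hA0
    have h : (fun y => ENNReal.ofReal (A.indicator (fun _ => (volume.real A)⁻¹) y)) =
        A.indicator fun _ => ENNReal.ofReal (volume.real A)⁻¹ := by
      ext y
      by_cases hy : y ∈ A <;> simp [hy]
    have hfin : volume A ≠ ⊤ := ne_top_of_le_ne_top (by simp) (measure_mono hA)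
    rw [h, withDensity_indicator hAm, withDensity_const]
    refine ⟨⟨?_⟩, ?_⟩
    · rw [Measure.smul_apply, Measure.restrict_apply_univ, smul_eq_mul, ← ofReal_measureReal hfin,
        ← ENNReal.ofReal_mul (by positivity), inv_mul_cancel₀ hA0.ne', ENNReal.ofReal_one]
    · have : (Icc 0 b)ᶜ ∩ A = ∅ := by
        ext y
        simp only [mem_inter_iff, mem_compl_iff, mem_empty_iff_false, iff_false, not_and]
        exact fun h hy => h (Ioo_subset_Icc_self (hA hy))
      simp [Measure.restrict_apply measurableSet_Icc.compl, this]
  -- The uniform law on (0, b) is a competitor with a finite value.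
  have hfin : entropy (Ioo 0 b) ν ≠ ⊤ := by
    intro htop
    have h := hmin _ (uniform_mem _ subset_rfl measurableSet_Ioo (by simpa using hb))
    rw [htop, entropy_withDensity (measurable_const.indicator measurableSet_Ioo)
      (fun y => indicator_nonneg (fun _ _ => by positivity) y), ← EReal.coe_add,
      EReal.coe_add_top, top_le_iff] at h
    · exact EReal.coe_ne_top _ h
    · refine IntegrableOn.congr_fun (f := fun _ => (volume.real (Ioo 0 b))⁻¹ *
        Real.log (volume.real (Ioo 0 b))⁻¹) (integrableOn_const (by simp)) (fun y hy => ?_)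
        measurableSet_Ioo
      simp [indicator_of_mem hy]
  have hac : ν ≪ volume ∧ IntegrableOn (fun y => (ν.rnDeriv volume y).toReal *
      Real.log (ν.rnDeriv volume y).toReal) (Ioo 0 b) := by
    by_contra h
    exact hfin (by rw [entropy, if_neg h])
  have hent : entropy (Ioo 0 b) ν = ((∫ y in Ioo 0 b, (ν.rnDeriv volume y).toReal *
      Real.log (ν.rnDeriv volume y).toReal : ℝ) : EReal) := by rw [entropy, if_pos hac]
  obtain ⟨hac, hlog⟩ := hac
  obtain ⟨ρ, hρ⟩ : ∃ ρ : ℝ → ℝ, ρ = fun y => (ν.rnDeriv volume y).toReal := ⟨_, rfl⟩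
  have hρm : Measurable ρ := hρ ▸ (Measure.measurable_rnDeriv ν volume).ennreal_toReal
  have hρ0 : ∀ y, 0 ≤ ρ y := fun y => hρ ▸ ENNReal.toReal_nonneg
  have hνρ : ν = volume.withDensity fun y => ENNReal.ofReal (ρ y) := by
    rw [← Measure.withDensity_rnDeriv_eq ν volume hac]
    refine withDensity_congr_ae ?_
    filter_upwards [Measure.rnDeriv_lt_top ν volume] with y hy
    rw [hρ, ENNReal.ofReal_toReal hy.ne]
  have hνI : ν (Ioo 0 b) = 1 := by
    have h2 : ν (Ioo 0 b) = ν (Icc 0 b) := measure_congr (hac.ae_le Ioo_ae_eq_Icc)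
    rw [h2, ← prob_compl_eq_zero_iff measurableSet_Icc]
    exact hmem.2
  have hint : IntegrableOn ρ (Ioo 0 b) := by
    rw [hρ]
    exact Measure.integrable_toReal_rnDeriv.integrableOn
  have hone : ∫ y in Ioo 0 b, ρ y = 1 := by
    rw [hρ, Measure.setIntegral_toReal_rnDeriv hac, measureReal_def, hνI, ENNReal.toReal_one]
  have key := ae_le_of_entropy_le_mix hb hρm hρ0 hint hone (hρ ▸ hlog) hm0 hm ?_
  · have hsub : Ioo y₀ y₁ ⊆ Ioo 0 b := Ioo_subset_Ioo h0 h1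
    calc ENNReal.ofReal (m * (y₁ - y₀)) = ∫⁻ _ in Ioo y₀ y₁, ENNReal.ofReal m := by
          rw [setLIntegral_const, Real.volume_Ioo, ENNReal.ofReal_mul hm0.le]
      _ ≤ ∫⁻ y in Ioo y₀ y₁, ENNReal.ofReal (ρ y) :=
          lintegral_mono_ae ((ae_restrict_of_ae_restrict_of_subset hsub key).mono fun y hy =>
            ENNReal.ofReal_le_ofReal hy)
      _ = ν (Ioo y₀ y₁) := by
          conv_rhs => rw [hνρ]
          rw [withDensity_apply _ measurableSet_Ioo]
      _ ≤ ν (Ioc y₀ y₁) := measure_mono Ioo_subset_Ioc_self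
  · intro A hA hAm hA0 ε hε0 hε1 a ha hinta
    have hσ := uniform_mem A hA hAm hA0
    have hs0 : ∀ y, 0 ≤ A.indicator (fun _ => (volume.real A)⁻¹) y :=
      fun y => indicator_nonneg (fun _ _ => by positivity) y
    have ham : Measurable a := by
      rw [show a = fun y => (1 - ε) * ρ y + ε * A.indicator (fun _ => (volume.real A)⁻¹) y from
        funext ha]
      exact (hρm.const_mul _).add ((measurable_const.indicator hAm).const_mul _)
    have ha0 : ∀ y, 0 ≤ a y := fun y => by
      rw [ha]
      exact add_nonneg (mul_nonneg (by linarith) (hρ0 y)) (mul_nonneg hε0.le (hs0 y))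
    have hmix : ENNReal.ofReal (1 - ε) • ν + ENNReal.ofReal ε • volume.withDensity
        (fun y => ENNReal.ofReal (A.indicator (fun _ => (volume.real A)⁻¹) y)) =
        volume.withDensity fun y => ENNReal.ofReal (a y) := by
      conv_lhs => rw [hνρ]
      rw [← withDensity_smul _ hρm.ennreal_ofReal,
        ← withDensity_smul _ (measurable_const.indicator hAm).ennreal_ofReal,
        ← withDensity_add_left (hρm.ennreal_ofReal.const_smul _)]
      congr 1
      ext y
      simp only [Pi.add_apply, Pi.smul_apply, smul_eq_mul, ha]
      rw [← ENNReal.ofReal_mul (by linarith), ← ENNReal.ofReal_mul hε0.le,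
        ← ENNReal.ofReal_add (mul_nonneg (by linarith) (hρ0 y)) (mul_nonneg hε0.le (hs0 y))]
    have h := hmin _ (add_smul_mem_probOn hmem hσ hε0.le hε1.le)
    have hT := transportCost_mix_le hmem hσ hε0.le hε1.le
    rw [hmix] at h hT
    rw [hent, entropy_withDensity ham ha0 hinta, ← EReal.coe_add, ← EReal.coe_add,
      EReal.coe_le_coe_iff] at h
    rw [hρ]
    linarith

/-! ### Existence of a mass splitting -/

theorem volume_line_eq_zero {s c : ℝ} (hc : c ≠ 0) (k : ℝ) :
    volume {x : EuclideanSpace ℝ (Fin 2) | x 0 * s - x 1 * c = k} = 0 := by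
  have hm : MeasurableSet {p : ℝ × ℝ | p.1 * s - p.2 * c = k} :=
    measurableSet_eq_fun (by fun_prop) (by fun_prop)
  refine (measurePreserving_coords.measure_preimage hm.nullMeasurableSet).trans ?_
  rw [Measure.volume_eq_prod, Measure.measure_prod_null hm]
  refine Filter.Eventually.of_forall fun u => ?_
  refine measure_mono_null (t := {(u * s - k) / c}) (fun v hv => ?_) (by simp)
  rw [mem_singleton_iff, eq_div_iff hc]
  have hv' : u * s - v * c = k := hv
  linarith

/-- The law η of ∂c/∂y under μ has no atoms, because its level sets are lines. Its distribution
function is therefore continuous, and the intermediate value theorem gives k. -/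
theorem exists_measure_superLevelSet_eq {y : ℝ} (hy : Real.cos y ≠ 0) {t : ENNReal} (ht : t ≤ 1) :
    ∃ k, quarterDiskUniform (superLevelSet quarterDisk arcCost y k) = t := by
  set L : EuclideanSpace ℝ (Fin 2) → ℝ := fun x => x 0 * Real.sin y - x 1 * Real.cos y with hL
  have hLm : Measurable L := by fun_prop
  set η := quarterDiskUniform.map L with hη
  have hηp : IsProbabilityMeasure η := Measure.isProbabilityMeasure_map hLm.aemeasurable
  have hηk : ∀ k, η {k} = 0 := fun k => by
    rw [hη, Measure.map_apply hLm (measurableSet_singleton k), quarterDiskUniform,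
      Measure.smul_apply, smul_eq_mul]
    refine mul_eq_zero_of_right _ (Measure.absolutelyContinuous_of_le Measure.restrict_le_self ?_)
    exact volume_line_eq_zero hy k
  have hηI : ∀ᵐ u ∂η, u ∈ Icc (-1 : ℝ) 1 := by
    refine (ae_map_iff hLm.aemeasurable measurableSet_Icc).2 ?_
    exact ae_mem_quarterDisk.mono fun x hx => abs_le.1 (abs_deriv_arcCost_le hx y)
  have hsup : ∀ k, quarterDiskUniform (superLevelSet quarterDisk arcCost y k) = η (Ici k) := by
    intro k
    rw [hη, Measure.map_apply hLm measurableSet_Ici]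
    refine measure_congr ?_
    filter_upwards [ae_mem_quarterDisk] with x hx
    refine propext ?_
    change (x ∈ quarterDisk ∧ k ≤ deriv (fun t => arcCost x t) y) ↔ k ≤ L x
    rw [deriv_arcCost]
    exact and_iff_right hx
  have hcdf : ∀ k, η.real (Ici k) = 1 - ProbabilityTheory.cdf η k := by
    intro k
    rw [ProbabilityTheory.cdf_eq_real, ← probReal_compl_eq_one_sub measurableSet_Iic, compl_Iic]
    exact measureReal_congr (Ioi_ae_eq_Ici' (hηk k)).symm
  have hcont : Continuous (ProbabilityTheory.cdf η) := by
    rw [continuous_iff_continuousAt]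
    intro k
    rw [(ProbabilityTheory.cdf η).mono.continuousAt_iff_leftLim_eq_rightLim,
      (ProbabilityTheory.cdf η).rightLim_eq]
    have h := (ProbabilityTheory.cdf η).measure_singleton k
    rw [ProbabilityTheory.measure_cdf, hηk, eq_comm, ENNReal.ofReal_eq_zero] at h
    exact le_antisymm ((ProbabilityTheory.cdf η).mono.leftLim_le le_rfl) (by linarith)
  have htop : t ≠ ⊤ := ne_top_of_le_ne_top ENNReal.one_ne_top ht
  -- As η lives on [-1, 1], its distribution function is 0 at -2 and 1 at 2.
  obtain ⟨k, hk⟩ := mem_range_of_exists_le_of_exists_ge (c := 1 - t.toReal) hcont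
    ⟨-2, by
      have : ProbabilityTheory.cdf η (-2) = 0 := by
        rw [ProbabilityTheory.cdf_eq_real, measureReal_eq_zero_iff]
        exact measure_eq_zero_iff_ae_notMem.2 (hηI.mono fun u hu h => by
          have h' : u ≤ -2 := h
          linarith [hu.1])
      rw [this, sub_nonneg]
      exact ENNReal.toReal_mono ENNReal.one_ne_top ht⟩
    ⟨2, by
      have : ProbabilityTheory.cdf η 2 = 1 := by
        rw [ProbabilityTheory.cdf_eq_real, measureReal_def,
          (prob_compl_eq_zero_iff measurableSet_Iic).1, ENNReal.toReal_one]
        exact measure_eq_zero_iff_ae_notMem.2 (hηI.mono fun u hu h => h (by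
          have : u ≤ 2 := by linarith [hu.2]
          exact this))
      rw [this]
      linarith [ENNReal.toReal_nonneg (a := t)]⟩
  refine ⟨k, ?_⟩
  rw [hsup, ← ENNReal.toReal_eq_toReal_iff' (measure_ne_top _ _) htop, ← measureReal_def, hcdf, hk]
  ring

/-! ### Nestedness -/

theorem isNested_of_isEntropicMinimizer {b : ℝ} (hb : 0 < b)
    (h : b ≤ Real.log ((1 + Real.sqrt (1 + 2 * Real.pi)) / 2)) {ν : Measure ℝ}
    (hν : IsEntropicMinimizer (Ioo 0 b) arcCost quarterDiskUniform ν) :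
    IsNested quarterDisk (Ioo 0 b) arcCost quarterDiskUniform ν := by
  have hνp := hν.1.1
  have hbpi : b < Real.pi / 2 := by
    have h1 := (abs_lt.1 abs_log_sub_lt).2
    have h2 := Real.pi_gt_three
    linarith
  rw [IsNested]
  simp only [IsMassSplitting, closure_Ioo hb.ne]
  refine ⟨?_, ?_⟩
  · have hex : ∀ y, ∃ k, y ∈ Icc 0 b →
        quarterDiskUniform (superLevelSet quarterDisk arcCost y k) = ν (Iic y) := by
      intro y
      by_cases hy : y ∈ Icc 0 b
      · have hc : 0 < Real.cos y := Real.cos_pos_of_mem_Ioo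
          ⟨by linarith [hy.1, Real.pi_pos], by linarith [hy.2]⟩
        obtain ⟨k, hk⟩ := exists_measure_superLevelSet_eq hc.ne' (prob_le_one (μ := ν) (s := Iic y))
        exact ⟨k, fun _ => hk⟩
      · exact ⟨0, fun h => absurd h hy⟩
    choose k hk using hex
    exact ⟨k, hk⟩
  · intro k hk y₀ hy₀ y₁ hy₁ hlt _ z hz
    by_contra hcon
    have hz0 : k y₀ ≤ z 0 * Real.sin y₀ - z 1 * Real.cos y₀ := deriv_arcCost z y₀ ▸ hz.2
    have hz1 : z 0 * Real.sin y₁ - z 1 * Real.cos y₁ ≤ k y₁ := by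
      by_contra! hgt
      refine hcon ⟨⟨hz.1, ?_⟩, fun hl => ?_⟩
      · rw [deriv_arcCost]
        exact hgt.le
      · have := hl.2
        rw [deriv_arcCost] at this
        linarith
    set W := {x | x ∈ quarterDisk ∧
      z 0 * Real.sin y₁ - z 1 * Real.cos y₁ ≤ x 0 * Real.sin y₁ - x 1 * Real.cos y₁ ∧
      x 0 * Real.sin y₀ - x 1 * Real.cos y₀ < z 0 * Real.sin y₀ - z 1 * Real.cos y₀} with hW
    have hWvol : volume W ≤ ENNReal.ofReal ((y₁ - y₀) / 2) :=
      volume_wedge_le hz.1 hy₀.1 hlt (hy₁.2.trans hbpi.le)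
    have hWμ : quarterDiskUniform W ≤ ENNReal.ofReal (2 / Real.pi * (y₁ - y₀)) := by
      rw [quarterDiskUniform, Measure.smul_apply, smul_eq_mul, volume_quarterDisk]
      refine (mul_le_mul_right ((Measure.restrict_apply_le _ _).trans hWvol) _).trans_eq ?_
      rw [← ENNReal.ofReal_inv_of_pos (by positivity), ← ENNReal.ofReal_mul (by positivity)]
      congr 1
      field_simp
      ring
    -- Since z is at or above level k y₀ for y₀ and at or below level k y₁ for y₁, any point gained
    -- in passing from y₀ to y₁ satisfies both wedge inequalities relative to z.
    have hsub : superLevelSet quarterDisk arcCost y₁ (k y₁) ⊆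
        superLevelSet quarterDisk arcCost y₀ (k y₀) ∪ W := by
      rintro x ⟨hx, hx1⟩
      rw [deriv_arcCost] at hx1
      by_cases hx0 : k y₀ ≤ x 0 * Real.sin y₀ - x 1 * Real.cos y₀
      · exact Or.inl ⟨hx, by rwa [deriv_arcCost]⟩
      · exact Or.inr ⟨hx, hz1.trans hx1, (not_le.1 hx0).trans_le hz0⟩
    have h1 := (measure_mono (μ := quarterDiskUniform) hsub).trans (measure_union_le _ _)
    rw [hk y₁ hy₁, hk y₀ hy₀, ← Iic_union_Ioc_eq_Iic hlt.le,
      measure_union (Iic_disjoint_Ioc le_rfl) measurableSet_Ioc] at h1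
    have h2 : ν (Ioc y₀ y₁) ≤ ENNReal.ofReal (2 / Real.pi * (y₁ - y₀)) :=
      (ENNReal.le_of_add_le_add_left (measure_ne_top _ _) h1).trans hWμ
    -- With m strictly between the two rates, ν((y₀, y₁]) is at least m(y₁ - y₀), which exceeds the
    -- wedge bound.
    obtain ⟨m, hm1, hm2⟩ := exists_between (two_div_pi_lt hb h)
    have hm0 : 0 < m := lt_trans (by positivity) hm1
    have h3 := (ofReal_mul_le_measure_Ioc_of_isEntropicMinimizer hb hm0 hm2 hν hy₀.1 hy₁.2).trans h2
    rw [ENNReal.ofReal_le_ofReal_iff (mul_nonneg (by positivity) (by linarith))] at h3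
    exact absurd (le_of_mul_le_mul_right h3 (by linarith)) (not_le.2 hm1)

end NestedOT

theorem mainTheorem6 :
    (∀ ybar : ℝ, 0 < ybar → ybar ≤ Real.log ((1 + Real.sqrt (1 + 2 * Real.pi)) / 2) →
      ∀ ν : Measure ℝ,
        NestedOT.IsEntropicMinimizer (Ioo 0 ybar) NestedOT.arcCost NestedOT.quarterDiskUniform ν →
        NestedOT.IsNested NestedOT.quarterDisk (Ioo 0 ybar) NestedOT.arcCost
          NestedOT.quarterDiskUniform ν) ∧
    |Real.log ((1 + Real.sqrt (1 + 2 * Real.pi)) / 2) - 0.61| < 0.005 :=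
  ⟨fun _ hb h _ hν => NestedOT.isNested_of_isEntropicMinimizer hb h hν, NestedOT.abs_log_sub_lt⟩
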